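/- **Theorem 9 (Full indexability).** Consider a service station with Poisson arrivals of rate $\lambda>0$ and a pool of $S\in\mathbb N$ servers. Whenever $a\in\{0,1,\dots,S\}$ servers are deployed and the head count is $n\ge 1$, services are completed at exponential rate $\mu(a)$, where $\mu(0)\ge 0$, $\mu$ is strictly increasing and strictly concave on $\{0,\dots,S\}$, and $\lambda<\mu(S)$. A deterministic stationary Markov (DSM) policy is a map $u:\mathbb N\to\{0,\dots,S\}$; under it the head count $n(t)$ is the birth-death Markov chain with birth rate $\lambda$ and death rate $\mu(u(n))$ in states $n\ge1$. For $h,W\ge 0$, let $P(h,W)$ be the problem of minimizing over DSM policies the average cost rate $\liminf_{t\to\infty}\frac1t\int_0^t\mathbb E_u[h\,n(s)+W\,u(n(s))]\,ds$; a policy is optimal if it attains the minimum from every initial state. Let $Q(h)=P(h,1)$. Let $\gamma(h)$ be the minimal average cost rate of $Q(h)$, and let the bias $v(h,\cdot)$ be the function with $v(h,0)=0$ that solves the optimality equations $$\lambda v(h,n)=hn+\lambda v(h,n+1)+\min_{0\le a\le S}\{a-\mu(a)\Delta v(h,n)\}-\gamma(h),\qquad n\ge 0,$$ where $\Delta v(h,n)=v(h,n)-v(h,n-1)$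 for $n\ge1$ and $\Delta v(h,0)=0$. Then: (i) For every $h\ge0$ the minimal cost rate $\gamma(h)$ is finite and does not depend on the initial state, and the bias $v(h,\cdot)$ exists and is unique. For every $n\ge1$ the function $h\mapsto\Delta v(h,n)$ is strictly increasing (in particular nondecreasing) on $[0,\infty)$. (ii) The station is fully indexable. In terms of the holding cost: there are DSM policies $u(h)$, $h\ge0$, such that $u(h)$ is optimal for $Q(h)$, $u(h,n)$ is nondecreasing in $n$, and for each $0\le a\le S-1$ we have $\{n:u(h,n)\le a\}=\{0,1,\dots,M(a,h)\}$ with $M(a,h)\in\mathbb N\cup\{\infty\}$ nonincreasing in $h$; so the server allocation in each state increases with $h$. Equivalently, in terms of the charge, for every fixed $h>0$: there are DSM policies $u(W)$, $W\ge0$, such that $u(W)$ is optimal for $P(h,W)$, $u(W,n)$ is nondecreasing in $n$, and for each $0\le a\le S-1$ we have $\{n:u(W,n)\le a\}=\{0,1,\dots,N(a,W)\}$ with $N(a,W)\in\mathbb N\cup\{\infty\}$ nondecreasing in $W$; so the server allocation in each state decreases with $W$. -/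

import Mathlib

open Set Filter MeasureTheory ProbabilityTheory
open scoped ENNReal NNReal Topology

/-- A single service station: Poisson arrivals at rate `lam`, a pool of `S` servers, and an
exponential team service rate `mu a` when `a` servers of the pool are deployed.
Only the values `mu 0, …, mu S` are ever used. A local team may be present (`mu 0 > 0`). -/
structure Station where
  lam : ℝ
  S : ℕ
  mu : ℕ → ℝ
  lam_pos : 0 < lam
  mu_zero_nonneg : 0 ≤ mu 0
  mu_increasing : ∀ a, a + 1 ≤ S → mu a < mu (a + 1)
  mu_strictConcave : ∀ a, a + 2 ≤ S → mu (a + 2) - mu (a + 1) < mu (a + 1) - mu a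
  stable : lam < mu S

namespace Station

/-- Deterministic stationary Markov policies: `u n` servers are deployed at head count `n`. -/
abbrev Policy (st : Station) : Type := ℕ → Fin (st.S + 1)

/-- The uniformization rate, a bound on all total transition rates. -/
def clockRate (st : Station) : ℝ := st.lam + st.mu st.S

/-- Law of the head count after one tick of the uniformizing clock: an arrival, a service
completion (void at head count `0`, since `0 - 1 = 0` in `ℕ`), or no event. -/
noncomputable def stepLaw (st : Station) (u : st.Policy) (n : ℕ) : Measure ℕ :=
  ENNReal.ofReal (st.lam / st.clockRate) • Measure.dirac (n + 1)
    + ENNReal.ofReal (st.mu (u n) / st.clockRate) • Measure.dirac (n - 1)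
    + ENNReal.ofReal ((st.mu st.S - st.mu (u n)) / st.clockRate) • Measure.dirac n

/-- Law of the head count after `k` ticks of the uniformizing clock, started at `n`. -/
noncomputable def tickLaw (st : Station) (u : st.Policy) : ℕ → ℕ → Measure ℕ
  | 0, n => Measure.dirac n
  | k + 1, n => (st.stepLaw u n).bind (st.tickLaw u k)

/-- Law of the head count `n(t)` under policy `u`, given `n(0) = n`: the birth-death
continuous-time Markov chain with birth rate `lam` and death rate `mu (u m)` at `m ≥ 1`,
the number of ticks during `[0, t]` being Poisson with mean `clockRate * t`. -/
noncomputable def law (st : Station) (u : st.Policy) (n : ℕ) (t : ℝ) : Measure ℕ :=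
  (poissonMeasure (st.clockRate * t).toNNReal).bind (fun k => st.tickLaw u k n)

theorem clockRate_pos (st : Station) : 0 < st.clockRate :=
  add_pos st.lam_pos (st.lam_pos.trans st.stable)

theorem mu_le (st : Station) {a b : ℕ} (hab : a ≤ b) (hb : b ≤ st.S) : st.mu a ≤ st.mu b := by
  induction b, hab using Nat.le_induction with
  | base => exact le_rfl
  | succ b _ ih => exact (ih (by omega)).trans (st.mu_increasing b hb).le

theorem mu_nonneg (st : Station) (a : Fin (st.S + 1)) : 0 ≤ st.mu a :=
  st.mu_zero_nonneg.trans (st.mu_le (Nat.zero_le _) (Nat.lt_succ_iff.mp a.2))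

instance stepLaw_isProbability (st : Station) (u : st.Policy) (n : ℕ) :
    IsProbabilityMeasure (st.stepLaw u n) := by
  have hc := st.clockRate_pos
  have h1 := st.mu_nonneg (u n)
  have h2 := sub_nonneg.2 (st.mu_le (Nat.lt_succ_iff.mp (u n).2) le_rfl)
  constructor
  simp only [stepLaw, Measure.coe_add, Measure.coe_smul, Pi.add_apply, Pi.smul_apply,
    measure_univ, smul_eq_mul, mul_one]
  rw [← ENNReal.ofReal_add (by have := st.lam_pos; positivity) (by positivity),
    ← ENNReal.ofReal_add (by have := st.lam_pos; positivity) (by positivity),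
    ← add_div, ← add_div]
  rw [show st.lam + st.mu (u n) + (st.mu st.S - st.mu (u n)) = st.clockRate by
    unfold clockRate; ring, div_self hc.ne', ENNReal.ofReal_one]

instance tickLaw_isProbability (st : Station) (u : st.Policy) (k n : ℕ) :
    IsProbabilityMeasure (st.tickLaw u k n) := by
  induction k generalizing n with
  | zero => unfold tickLaw; infer_instance
  | succ k ih =>
    constructor
    unfold tickLaw
    rw [Measure.bind_apply .univ Measurable.of_discrete.aemeasurable]
    simp

instance law_isProbability (st : Station) (u : st.Policy) (n : ℕ) (t : ℝ) :
    IsProbabilityMeasure (st.law u n t) := by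
  constructor
  unfold law
  rw [Measure.bind_apply .univ Measurable.of_discrete.aemeasurable]
  simp

theorem tickLaw_succ_real (st : Station) (u : st.Policy) (k n m : ℕ) :
    st.clockRate * (st.tickLaw u (k + 1) n).real {m} =
      st.lam * (st.tickLaw u k (n + 1)).real {m}
        + st.mu (u n) * (st.tickLaw u k (n - 1)).real {m}
        + (st.mu st.S - st.mu (u n)) * (st.tickLaw u k n).real {m} := by
  have hc := st.clockRate_pos
  have h0 := st.lam_pos
  have h1 := st.mu_nonneg (u n)
  have h2 := sub_nonneg.2 (st.mu_le (Nat.lt_succ_iff.mp (u n).2) le_rfl)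
  have key : (st.tickLaw u (k + 1) n).real {m} =
      st.lam / st.clockRate * (st.tickLaw u k (n + 1)).real {m}
        + st.mu (u n) / st.clockRate * (st.tickLaw u k (n - 1)).real {m}
        + (st.mu st.S - st.mu (u n)) / st.clockRate * (st.tickLaw u k n).real {m} := by
    simp only [Measure.real]
    conv_lhs => unfold tickLaw
    rw [Measure.bind_apply (by measurability) Measurable.of_discrete.aemeasurable, stepLaw]
    simp only [lintegral_add_measure, lintegral_smul_measure, lintegral_dirac, smul_eq_mul]
    rw [ENNReal.toReal_add, ENNReal.toReal_add, ENNReal.toReal_mul, ENNReal.toReal_mul,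
      ENNReal.toReal_mul, ENNReal.toReal_ofReal, ENNReal.toReal_ofReal, ENNReal.toReal_ofReal]
    all_goals first | positivity | finiteness
  rw [key]; field_simp

theorem law_real (st : Station) (u : st.Policy) (n m : ℕ) {t : ℝ} (ht : 0 ≤ t) :
    (st.law u n t).real {m} = Real.exp (-(st.clockRate * t)) *
      ∑' k : ℕ, (st.tickLaw u k n).real {m} * ((st.clockRate * t) ^ k / (k.factorial : ℝ)) := by
  have hc : 0 ≤ st.clockRate * t := mul_nonneg st.clockRate_pos.le ht
  rw [Measure.real, law, Measure.bind_apply (by measurability)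
    Measurable.of_discrete.aemeasurable, ← integral_toReal Measurable.of_discrete.aemeasurable
    (Eventually.of_forall fun _ => measure_lt_top _ _), integral_poissonMeasure, ← tsum_mul_left]
  refine tsum_congr fun k => ?_
  simp only [Real.coe_toNNReal _ hc, Measure.real, smul_eq_mul]
  ring

theorem hasDerivAt_series (g : ℕ → ℝ) (hg : ∀ k, |g k| ≤ 1) (s : ℝ) :
    HasDerivAt (fun s : ℝ => ∑' k : ℕ, g k * (s ^ k / (k.factorial : ℝ)))
      (∑' k : ℕ, g (k + 1) * (s ^ k / (k.factorial : ℝ))) s := by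
  set R := |s| + 1 with hR
  have hR0 : 0 ≤ R := by positivity
  let g' : ℕ → ℝ → ℝ := fun k y => g k * ((k * y ^ (k - 1)) / (k.factorial : ℝ))
  let b : ℕ → ℝ := fun k => (k * R ^ (k - 1)) / (k.factorial : ℝ)
  have hshift : ∀ (k : ℕ) (y : ℝ),
      (((k + 1 : ℕ) : ℝ) * y ^ (k + 1 - 1)) / ((k + 1).factorial : ℝ)
        = y ^ k / (k.factorial : ℝ) := by
    intro k y
    have h1 : (k.factorial : ℝ) ≠ 0 := by positivity
    rw [Nat.factorial_succ]
    push_cast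
    field_simp
  have hb : Summable b := by
    rw [← summable_nat_add_iff 1]
    exact (Real.summable_pow_div_factorial R).congr fun k => (hshift k R).symm
  have hmem : s ∈ Ioo (-R) R := by
    refine abs_lt.1 ?_; linarith
  have key := hasDerivAt_tsum_of_isPreconnected (u := b) (t := Ioo (-R) R)
    (g := fun k y => g k * (y ^ k / (k.factorial : ℝ))) (g' := g') hb isOpen_Ioo
    isPreconnected_Ioo
    (fun k y _ => ((hasDerivAt_pow k y).div_const _).const_mul _)
    (fun k y hy => by
      have hy' : |y| ≤ R := (abs_lt.2 hy).le
      simp only [g', b, norm_mul, norm_div, norm_pow, Real.norm_eq_abs, Nat.abs_cast]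
      refine (mul_le_mul_of_nonneg_right (hg k) (by positivity)).trans ?_
      rw [one_mul]
      gcongr)
    hmem
    (.of_norm_bounded (Real.summable_pow_div_factorial |s|) fun k => by
      simp only [norm_mul, norm_div, norm_pow, Real.norm_eq_abs, Nat.abs_cast]
      refine (mul_le_mul_of_nonneg_right (hg k) (by positivity)).trans ?_
      rw [one_mul])
    hmem
  have hs : Summable fun k => g' k s := by
    refine .of_norm_bounded hb fun k => ?_
    have hy' : |s| ≤ R := by linarith
    simp only [g', b, norm_mul, norm_div, norm_pow, Real.norm_eq_abs, Nat.abs_cast]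
    refine (mul_le_mul_of_nonneg_right (hg k) (by positivity)).trans ?_
    rw [one_mul]
    gcongr
  rw [hs.tsum_eq_zero_add] at key
  refine key.congr_deriv ?_
  have h0 : g' 0 s = 0 := by simp [g']
  rw [h0, zero_add]
  exact tsum_congr fun k => by simp only [g', hshift]

/-- The transition probabilities of `law` satisfy the Kolmogorov backward equation of the
birth-death chain with birth rate `lam` and death rate `mu (u n)` at `n ≥ 1`. -/
theorem law_backward (st : Station) (u : st.Policy) (n m : ℕ) {t : ℝ} (ht : 0 ≤ t) :
    HasDerivWithinAt (fun t => (st.law u n t).real {m})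
      (st.lam * ((st.law u (n + 1) t).real {m} - (st.law u n t).real {m})
        + st.mu (u n) * ((st.law u (n - 1) t).real {m} - (st.law u n t).real {m}))
      (Ici 0) t := by
  set c := st.clockRate with hcdef
  have hg : ∀ n k, |(st.tickLaw u k n).real {m}| ≤ 1 := fun n k => by
    rw [abs_of_nonneg measureReal_nonneg]; exact measureReal_le_one
  have hsum : ∀ n, Summable fun k : ℕ =>
      (st.tickLaw u k n).real {m} * ((c * t) ^ k / (k.factorial : ℝ)) := fun n =>
    .of_norm_bounded (Real.summable_pow_div_factorial |c * t|) fun k => by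
      simp only [norm_mul, norm_div, norm_pow, Real.norm_eq_abs, Nat.abs_cast]
      refine (mul_le_mul_of_nonneg_right (hg n k) (by positivity)).trans ?_
      rw [one_mul, ← abs_mul]
  have hlin : HasDerivAt (fun t : ℝ => c * t) c t := by
    simpa using (hasDerivAt_id t).const_mul c
  have hser := (hasDerivAt_series _ (hg n) (c * t)).comp t hlin
  have hexp := hlin.neg.exp
  have hmul := (hexp.mul hser).hasDerivWithinAt (s := Ici 0)
  refine (hmul.congr_of_mem (fun s hs => st.law_real u n m hs) ht).congr_deriv ?_
  rw [st.law_real u n m ht, st.law_real u (n + 1) m ht, st.law_real u (n - 1) m ht]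
  have hrec : c * ∑' k : ℕ, (st.tickLaw u (k + 1) n).real {m} * ((c * t) ^ k / (k.factorial : ℝ))
      = st.lam * ∑' k : ℕ, (st.tickLaw u k (n + 1)).real {m} * ((c * t) ^ k / (k.factorial : ℝ))
        + st.mu (u n) *
          ∑' k : ℕ, (st.tickLaw u k (n - 1)).real {m} * ((c * t) ^ k / (k.factorial : ℝ))
        + (st.mu st.S - st.mu (u n)) *
          ∑' k : ℕ, (st.tickLaw u k n).real {m} * ((c * t) ^ k / (k.factorial : ℝ)) := by
    rw [← tsum_mul_left, ← tsum_mul_left, ← tsum_mul_left, ← tsum_mul_left,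
      ← ((hsum (n + 1)).mul_left _).tsum_add ((hsum (n - 1)).mul_left _),
      ← (((hsum (n + 1)).mul_left _).add ((hsum (n - 1)).mul_left _)).tsum_add
        ((hsum n).mul_left _)]
    refine tsum_congr fun k => ?_
    have := st.tickLaw_succ_real u k n m
    rw [← hcdef] at this
    linear_combination ((c * t) ^ k / (k.factorial : ℝ)) * this
  have hcS : c = st.lam + st.mu st.S := rfl
  simp only [Function.comp_apply, ← hcdef]
  generalize (∑' k : ℕ, (st.tickLaw u (k + 1) n).real {m} * ((c * t) ^ k / (k.factorial : ℝ))) = A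
    at hrec ⊢
  generalize (∑' k : ℕ, (st.tickLaw u k n).real {m} * ((c * t) ^ k / (k.factorial : ℝ))) = B
    at hrec ⊢
  linear_combination Real.exp (-(c * t)) * hrec
    - Real.exp (-(c * t)) * B * hcS

/-- Cost rate with holding cost `h` per customer and charge `W` per deployed server. -/
noncomputable def costRate (st : Station) (h W : ℝ) (u : st.Policy) (n : ℕ) : ℝ≥0∞ :=
  ENNReal.ofReal (h * n + W * ((u n : ℕ) : ℝ))

/-- Long-run average cost rate of policy `u` from the initial head count `n`,
`liminf_{t → ∞} (1 / t) ∫_0^t 𝔼 [cost rate at time s] ds`. -/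
noncomputable def avgCost (st : Station) (h W : ℝ) (u : st.Policy) (n : ℕ) : ℝ≥0∞ :=
  liminf (fun t : ℝ =>
    (∫⁻ s in Ioc 0 t, ∫⁻ m, st.costRate h W u m ∂(st.law u n s)) / ENNReal.ofReal t) atTop

/-- Minimal average cost rate from the initial head count `n`. -/
noncomputable def minCost (st : Station) (h W : ℝ) (n : ℕ) : ℝ≥0∞ :=
  ⨅ u : st.Policy, st.avgCost h W u n

/-- A policy is optimal if it attains the minimal average cost rate from every initial state. -/
def IsOptimal (st : Station) (h W : ℝ) (u : st.Policy) : Prop :=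
  ∀ n, st.avgCost h W u n = st.minCost h W n

/-- Bias differences `Δv(n) = v(n) - v(n - 1)` for `n ≥ 1`, with `Δv(0) = 0`. -/
def diff (v : ℕ → ℝ) : ℕ → ℝ
  | 0 => 0
  | n + 1 => v (n + 1) - v n

/-- `v` is the bias function for unit server charge and holding cost `h`: it vanishes at `0`
and, together with the minimal average cost rate `γ`, solves the optimality equations. -/
def IsBias (st : Station) (h : ℝ) (v : ℕ → ℝ) : Prop :=
  v 0 = 0 ∧ ∃ γ : ℝ≥0, (∀ n, st.minCost h 1 n = γ) ∧
    ∀ n : ℕ, st.lam * v n = h * n + st.lam * v (n + 1)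
      + Finset.univ.inf' Finset.univ_nonempty
          (fun a : Fin (st.S + 1) => ((a : ℕ) : ℝ) - st.mu a * diff v n)
      - γ

/-- Full indexability in terms of the server charge `W`, for holding cost rate `h`: monotone
optimal policies `u W` with `{n | u W n ≤ a} = {0, …, N a W}` and `N a W` increasing in `W`. -/
def FullyIndexableInCharge (st : Station) (h : ℝ) : Prop :=
  ∃ (u : ℝ → st.Policy) (N : ℕ → ℝ → ℕ∞),
    (∀ W, 0 ≤ W → st.IsOptimal h W (u W) ∧ Monotone (u W) ∧
      ∀ a < st.S, {n : ℕ | (u W n : ℕ) ≤ a} = {n : ℕ | (n : ℕ∞) ≤ N a W}) ∧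
    ∀ a < st.S, MonotoneOn (N a) (Ici 0)

/-- Full indexability in terms of the holding cost rate `h`, for unit server charge: monotone
optimal policies `u h` with `{n | u h n ≤ a} = {0, …, M a h}` and `M a h` decreasing in `h`. -/
def FullyIndexableInHolding (st : Station) : Prop :=
  ∃ (u : ℝ → st.Policy) (M : ℕ → ℝ → ℕ∞),
    (∀ h, 0 ≤ h → st.IsOptimal h 1 (u h) ∧ Monotone (u h) ∧
      ∀ a < st.S, {n : ℕ | (u h n : ℕ) ≤ a} = {n : ℕ | (n : ℕ∞) ≤ M a h}) ∧
    ∀ a < st.S, AntitoneOn (M a) (Ici 0)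

end Station

/-!
Write `x n` for the bias difference in state `n`. With
`H x = min_a (W a - mu a * x)`, the optimality equations read `x 0 = 0` and
`lam * x (n + 1) = γ - h n - H (x n)`, so a trial cost rate `γ` determines all bias differences.
The optimal rate `optRate` is the least `γ` for which they never become negative. For `h > 0` the
resulting sequence `optDiff` is strictly increasing, as a single decrease would lead below `0`, and
tends to infinity. Minimality of `γ` keeps it below the affine solution for the policy that deploys
all servers, and since deviations from that solution grow geometrically (`lam < mu S`), it
coincides with it in all late states (`eventually_optDiff_eq_line`).

Monotonicity in `h` (`optDiff_lt_optDiff`): if the bias differences for `h' > h` fell to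
those for `h` in some nonempty state, then `- h' n` would outweigh the gain in `γ`, `H` being
antitone, and the inequality would persist for ever; but the affine tail for `h'` is steeper.

That `optRate` is the minimal cost rate is shown by Dynkin's formula for the uniformized chain, in
which the time spent at each number of clock ticks is explicit. The partial sums of `optDiff` are a
nonnegative solution for the greedy policy, which gives the upper bound. For the lower bound the
differences are multiplied by `θ < 1` and ramped down to `0` beyond a late state; the holding cost
pays for the ramp, so this is a bounded subsolution with rate `θ * optRate`
(`exists_ramp_subsolution`), and `θ → 1`.

The greedy policy takes the least minimizer in `H`, which increases with `x`; hence it is monotone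
in the state and in `h`, and its level sets are thresholds. The claim about the charge follows by
scaling the costs by `W`; the charge `W = 0` is compared directly.
-/

namespace Station

/-! ### The one-step minimization -/

/-- The minimum over the team size `a` of `W a - mu a * x`: the server charge net of the value of
the services, when every departure saves `x`. -/
noncomputable def hamiltonian (st : Station) (W x : ℝ) : ℝ :=
  Finset.univ.inf' Finset.univ_nonempty
    (fun a : Fin (st.S + 1) => W * ((a : ℕ) : ℝ) - st.mu a * x)

theorem hamiltonian_le (st : Station) (W x : ℝ) (a : Fin (st.S + 1)) :
    st.hamiltonian W x ≤ W * ((a : ℕ) : ℝ) - st.mu a * x :=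
  Finset.inf'_le (fun a : Fin (st.S + 1) => W * ((a : ℕ) : ℝ) - st.mu a * x) (Finset.mem_univ a)

theorem le_hamiltonian {st : Station} {W x y : ℝ}
    (hy : ∀ a : Fin (st.S + 1), y ≤ W * ((a : ℕ) : ℝ) - st.mu a * x) : y ≤ st.hamiltonian W x :=
  Finset.le_inf' _ _ fun a _ => hy a

theorem hamiltonian_le_full (st : Station) (W x : ℝ) :
    st.hamiltonian W x ≤ W * st.S - st.mu st.S * x := by
  simpa using st.hamiltonian_le W x (Fin.last st.S)

theorem hamiltonian_antitone (st : Station) (W : ℝ) : Antitone (st.hamiltonian W) :=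
  fun _ y hxy => le_hamiltonian fun a => (st.hamiltonian_le W y a).trans
    (sub_le_sub_left (mul_le_mul_of_nonneg_left hxy (st.mu_nonneg a)) _)

theorem continuous_hamiltonian (st : Station) (W : ℝ) : Continuous (st.hamiltonian W) := by
  unfold hamiltonian
  exact Continuous.finset_inf'_apply _ fun a _ => by fun_prop

theorem hamiltonian_zero (st : Station) {W : ℝ} (hW : 0 ≤ W) : st.hamiltonian W 0 = 0 := by
  refine le_antisymm ?_ (le_hamiltonian fun a => ?_)
  · simpa using st.hamiltonian_le W 0 0
  · rw [mul_zero, sub_zero]; positivity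

/-- The Hamiltonian is concave and vanishes at `0`. -/
theorem mul_hamiltonian_le (st : Station) {W t : ℝ} (hW : 0 ≤ W) (ht0 : 0 ≤ t) (ht1 : t ≤ 1)
    (x : ℝ) : t * st.hamiltonian W x ≤ st.hamiltonian W (t * x) := by
  refine le_hamiltonian fun a => ?_
  have h1 := mul_le_mul_of_nonneg_left (st.hamiltonian_le W x a) ht0
  have h2 : 0 ≤ (1 - t) * (W * ((a : ℕ) : ℝ)) := by
    have := sub_nonneg.2 ht1
    positivity
  nlinarith

theorem mu_lt (st : Station) {a : ℕ} (ha : a < st.S) : st.mu a < st.mu st.S :=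
  (st.mu_increasing a ha).trans_le (st.mu_le ha le_rfl)

/-- When departures are valuable enough, deploying the whole pool is best. -/
theorem eventually_hamiltonian_eq (st : Station) (W : ℝ) :
    ∀ᶠ x in atTop, st.hamiltonian W x = W * st.S - st.mu st.S * x := by
  have key : ∀ a : Fin (st.S + 1), ∀ᶠ x : ℝ in atTop,
      W * st.S - st.mu st.S * x ≤ W * ((a : ℕ) : ℝ) - st.mu a * x := by
    intro a
    rcases (Nat.lt_succ_iff.mp a.2).lt_or_eq with ha | ha
    · have hpos := sub_pos.2 (st.mu_lt ha)
      filter_upwards [eventually_ge_atTop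
        ((W * st.S - W * ((a : ℕ) : ℝ)) / (st.mu st.S - st.mu a))] with x hx
      rw [div_le_iff₀ hpos] at hx
      linarith
    · simp [ha]
  filter_upwards [eventually_all.2 key] with x hx
  exact le_antisymm (st.hamiltonian_le_full W x) (le_hamiltonian hx)

open Classical in
theorem minimizers_nonempty (st : Station) (W x : ℝ) :
    (Finset.univ.filter fun a : Fin (st.S + 1) =>
      W * ((a : ℕ) : ℝ) - st.mu a * x = st.hamiltonian W x).Nonempty := by
  obtain ⟨a, -, ha⟩ := Finset.exists_mem_eq_inf' (Finset.univ_nonempty (α := Fin (st.S + 1)))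
    (fun a : Fin (st.S + 1) => W * ((a : ℕ) : ℝ) - st.mu a * x)
  exact ⟨a, Finset.mem_filter.2 ⟨Finset.mem_univ _, ha.symm⟩⟩

open Classical in
/-- The smallest team size attaining the Hamiltonian. -/
noncomputable def greedy (st : Station) (W x : ℝ) : Fin (st.S + 1) :=
  (Finset.univ.filter fun a : Fin (st.S + 1) =>
    W * ((a : ℕ) : ℝ) - st.mu a * x = st.hamiltonian W x).min' (st.minimizers_nonempty W x)

theorem greedy_spec (st : Station) (W x : ℝ) :
    W * ((st.greedy W x : ℕ) : ℝ) - st.mu (st.greedy W x) * x = st.hamiltonian W x := by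
  classical
  have h := Finset.min'_mem _ (st.minimizers_nonempty W x)
  rw [Finset.mem_filter] at h
  exact h.2

theorem greedy_le {st : Station} {W x : ℝ} {a : Fin (st.S + 1)}
    (ha : W * ((a : ℕ) : ℝ) - st.mu a * x = st.hamiltonian W x) : st.greedy W x ≤ a := by
  classical
  exact Finset.min'_le _ a (by simpa using ha)

/-- The cost `W a - mu a * x` has decreasing differences in `(a, x)`, so its minimizer
increases with `x`. -/
theorem greedy_monotone (st : Station) (W : ℝ) : Monotone (st.greedy W) := by
  intro x y hxy
  by_contra! hlt
  have h1 := st.greedy_spec W x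
  have h2 := st.greedy_spec W y
  have h3 := st.hamiltonian_le W y (st.greedy W x)
  have h4 : st.hamiltonian W x <
      W * ((st.greedy W y : ℕ) : ℝ) - st.mu (st.greedy W y) * x :=
    lt_of_le_of_ne (st.hamiltonian_le W x _) fun h => (greedy_le h.symm).not_gt hlt
  have h5 : st.mu (st.greedy W y) ≤ st.mu (st.greedy W x) :=
    st.mu_le (Fin.le_def.1 hlt.le) (Nat.lt_succ_iff.mp (st.greedy W x).2)
  nlinarith

theorem greedy_zero (st : Station) {W : ℝ} (hW : 0 ≤ W) : st.greedy W 0 = 0 :=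
  le_antisymm (greedy_le (by simp [st.hamiltonian_zero hW])) (Fin.zero_le _)

/-- Free servers are all deployed as soon as departures are valuable. -/
theorem greedy_zero_charge (st : Station) {x : ℝ} (hx : 0 < x) :
    st.greedy 0 x = Fin.last st.S := by
  by_contra hne
  have hlt : (st.greedy 0 x : ℕ) < st.S := Fin.lt_last_iff_ne_last.2 hne
  have h1 := st.greedy_spec 0 x
  have h2 := st.hamiltonian_le_full 0 x
  have h3 := mul_lt_mul_of_pos_right (st.mu_lt hlt) hx
  simp only [zero_mul] at h1 h2
  linarith

/-! ### Bias differences for a trial cost rate -/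

/-- The bias differences that the optimality equations force on a trial cost rate `γ`. The clause
for `n + 1` also covers the empty state, since the Hamiltonian vanishes at `0` when `0 ≤ W`. -/
noncomputable def biasDiff (st : Station) (h W γ : ℝ) : ℕ → ℝ
  | 0 => 0
  | n + 1 => (γ - h * n - st.hamiltonian W (biasDiff st h W γ n)) / st.lam

theorem lam_mul_biasDiff_succ (st : Station) (h W γ : ℝ) (n : ℕ) :
    st.lam * st.biasDiff h W γ (n + 1) =
      γ - h * n - st.hamiltonian W (st.biasDiff h W γ n) := by
  rw [biasDiff, mul_div_cancel₀ _ st.lam_pos.ne']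

theorem continuous_biasDiff (st : Station) (h W : ℝ) (n : ℕ) :
    Continuous fun γ => st.biasDiff h W γ n := by
  induction n with
  | zero => simpa only [biasDiff] using continuous_const
  | succ n ih =>
    simp only [biasDiff]
    exact ((continuous_id.sub continuous_const).sub
      ((st.continuous_hamiltonian W).comp ih)).div_const _

/-- The trial cost rates whose bias differences never become negative. -/
def feasibleRates (st : Station) (h W : ℝ) : Set ℝ :=
  {γ | ∀ n, 0 ≤ st.biasDiff h W γ n}

/-- The least feasible trial cost rate; it is the minimal average cost rate. -/
noncomputable def optRate (st : Station) (h W : ℝ) : ℝ := sInf (st.feasibleRates h W)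

/-- The bias differences at the optimal cost rate. -/
noncomputable def optDiff (st : Station) (h W : ℝ) : ℕ → ℝ :=
  st.biasDiff h W (st.optRate h W)

/-- The slope of the bias differences of the policy that deploys all servers. -/
noncomputable def slope (st : Station) (h : ℝ) : ℝ := h / (st.mu st.S - st.lam)

/-- The affine solution of the recursion for the bias differences when all servers are
deployed in every state. -/
noncomputable def line (st : Station) (h W γ : ℝ) (n : ℕ) : ℝ :=
  st.slope h * n + (st.lam * st.slope h + W * st.S - γ) / (st.mu st.S - st.lam)

theorem slope_nonneg (st : Station) {h : ℝ} (hh : 0 ≤ h) : 0 ≤ st.slope h :=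
  div_nonneg hh (sub_pos.2 st.stable).le

theorem slope_mul (st : Station) (h : ℝ) : st.slope h * (st.mu st.S - st.lam) = h :=
  div_mul_cancel₀ _ (sub_pos.2 st.stable).ne'

theorem slope_lt_slope (st : Station) {h h' : ℝ} (hh : h < h') : st.slope h < st.slope h' :=
  div_lt_div_of_pos_right hh (sub_pos.2 st.stable)

theorem line_succ (st : Station) (h W γ : ℝ) (n : ℕ) :
    st.line h W γ (n + 1) = st.line h W γ n + st.slope h := by
  simp only [line]; push_cast; ring

theorem lam_mul_line_succ (st : Station) (h W γ : ℝ) (n : ℕ) :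
    st.lam * st.line h W γ (n + 1) = γ - h * n - W * st.S + st.mu st.S * st.line h W γ n := by
  have h1 := st.slope_mul h
  have hne := (sub_pos.2 st.stable).ne'
  have h2 : (st.lam * st.slope h + W * st.S - γ) / (st.mu st.S - st.lam)
      * (st.mu st.S - st.lam) = st.lam * st.slope h + W * st.S - γ := div_mul_cancel₀ _ hne
  simp only [line]
  push_cast
  linear_combination -(n : ℝ) * h1 - h2

/-- Above the affine solution, the bias differences stay above it. -/
theorem line_le_biasDiff (st : Station) {h W γ : ℝ} {n : ℕ}
    (hn : st.line h W γ n ≤ st.biasDiff h W γ n) {m : ℕ} (hm : n ≤ m) :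
    st.line h W γ m ≤ st.biasDiff h W γ m := by
  induction m, hm using Nat.le_induction with
  | base => exact hn
  | succ m _ ih =>
    have h1 := st.lam_mul_biasDiff_succ h W γ m
    have h2 := st.lam_mul_line_succ h W γ m
    have h3 := st.hamiltonian_le_full W (st.biasDiff h W γ m)
    have h4 := mul_le_mul_of_nonneg_left ih (st.lam_pos.trans st.stable).le
    refine le_of_mul_le_mul_left ?_ st.lam_pos
    linarith

theorem nonneg_of_mem_feasibleRates {st : Station} {h W γ : ℝ} (hW : 0 ≤ W)
    (hγ : γ ∈ st.feasibleRates h W) : 0 ≤ γ := by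
  have h1 := st.lam_mul_biasDiff_succ h W γ 0
  have h2 := mul_nonneg st.lam_pos.le (hγ 1)
  rw [biasDiff, st.hamiltonian_zero hW] at h1
  simp only [CharP.cast_eq_zero, mul_zero, sub_zero, zero_add] at h1
  linarith

theorem bddBelow_feasibleRates (st : Station) {h W : ℝ} (hW : 0 ≤ W) :
    BddBelow (st.feasibleRates h W) :=
  ⟨0, fun _ hγ => nonneg_of_mem_feasibleRates hW hγ⟩

/-- The cost rate of the policy that deploys all servers is feasible. -/
theorem full_mem_feasibleRates (st : Station) {h : ℝ} (W : ℝ) (hh : 0 ≤ h) :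
    st.lam * st.slope h + W * st.S ∈ st.feasibleRates h W := by
  have hs := st.slope_nonneg hh
  have hline : ∀ n : ℕ, st.line h W (st.lam * st.slope h + W * st.S) n = st.slope h * n := by
    intro n; simp [line]
  intro n
  have h0 : st.line h W (st.lam * st.slope h + W * st.S) 0 ≤
      st.biasDiff h W (st.lam * st.slope h + W * st.S) 0 := by
    rw [hline]; simp [biasDiff]
  refine le_trans ?_ (st.line_le_biasDiff h0 (Nat.zero_le n))
  rw [hline]; positivity

theorem isClosed_feasibleRates (st : Station) (h W : ℝ) : IsClosed (st.feasibleRates h W) := by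
  simp only [feasibleRates, ofPred_forall]
  exact isClosed_iInter fun n => isClosed_le continuous_const (st.continuous_biasDiff h W n)

theorem optRate_mem (st : Station) {h W : ℝ} (hh : 0 ≤ h) (hW : 0 ≤ W) :
    st.optRate h W ∈ st.feasibleRates h W :=
  (st.isClosed_feasibleRates h W).csInf_mem ⟨_, st.full_mem_feasibleRates W hh⟩
    (st.bddBelow_feasibleRates hW)

theorem optRate_nonneg (st : Station) {h W : ℝ} (hh : 0 ≤ h) (hW : 0 ≤ W) :
    0 ≤ st.optRate h W :=
  nonneg_of_mem_feasibleRates hW (st.optRate_mem hh hW)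

theorem optDiff_nonneg (st : Station) {h W : ℝ} (hh : 0 ≤ h) (hW : 0 ≤ W) (n : ℕ) :
    0 ≤ st.optDiff h W n :=
  st.optRate_mem hh hW n

theorem optDiff_zero (st : Station) (h W : ℝ) : st.optDiff h W 0 = 0 := rfl

theorem lam_mul_optDiff_succ (st : Station) (h W : ℝ) (n : ℕ) :
    st.lam * st.optDiff h W (n + 1) =
      st.optRate h W - h * n - st.hamiltonian W (st.optDiff h W n) :=
  st.lam_mul_biasDiff_succ h W _ n

/-! ### Shape of the optimal bias differences -/

/-- A first decrease would propagate with slope at least `h / lam` and lead below `0`. -/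
theorem strictMono_optDiff (st : Station) {h W : ℝ} (hh : 0 < h) (hW : 0 ≤ W) :
    StrictMono (st.optDiff h W) := by
  refine strictMono_nat_of_lt_succ fun n => ?_
  by_contra! hle
  have hlam := st.lam_pos
  have key : ∀ k : ℕ, st.optDiff h W (n + k + 1) ≤ st.optDiff h W (n + k) ∧
      st.lam * st.optDiff h W (n + k + 1) ≤ st.lam * st.optDiff h W n - k * h := by
    intro k
    induction k with
    | zero => exact ⟨hle, by simpa using mul_le_mul_of_nonneg_left hle hlam.le⟩
    | succ k ih =>
      have h1 := st.lam_mul_optDiff_succ h W (n + k)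
      have h2 := st.lam_mul_optDiff_succ h W (n + k + 1)
      have h3 := st.hamiltonian_antitone W ih.1
      have h4 := ih.2
      rw [← add_assoc]
      push_cast at h1 h2 ⊢
      exact ⟨le_of_mul_le_mul_left (by linarith) hlam, by linarith⟩
  obtain ⟨k, hk⟩ := exists_nat_gt (st.lam * st.optDiff h W n / h)
  rw [div_lt_iff₀ hh] at hk
  have h1 := (key k).2
  have h2 := mul_nonneg hlam.le (st.optDiff_nonneg hh.le hW (n + k + 1))
  linarith

/-- A bounded monotone solution is impossible, since the term `- h * n` would drive it below `0`. -/
theorem tendsto_optDiff (st : Station) {h W : ℝ} (hh : 0 < h) (hW : 0 ≤ W) :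
    Tendsto (st.optDiff h W) atTop atTop := by
  refine tendsto_atTop_atTop_of_monotone (st.strictMono_optDiff hh hW).monotone fun b => ?_
  by_contra! hb
  obtain ⟨n, hn⟩ := exists_nat_gt ((st.optRate h W - st.hamiltonian W b) / h)
  rw [div_lt_iff₀ hh] at hn
  have h1 := st.lam_mul_optDiff_succ h W n
  have h2 := mul_nonneg st.lam_pos.le (st.optDiff_nonneg hh.le hW (n + 1))
  have h3 := st.hamiltonian_antitone W (hb n).le
  linarith

theorem tendsto_line (st : Station) {h : ℝ} (hh : 0 < h) (W γ : ℝ) :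
    Tendsto (st.line h W γ) atTop atTop :=
  tendsto_atTop_add_const_right _ _ (tendsto_natCast_atTop_atTop.const_mul_atTop
    (div_pos hh (sub_pos.2 st.stable)))

/-- If the optimal bias differences exceeded the affine solution at some late state, the same
would hold for a slightly smaller cost rate, which would then be feasible. -/
theorem eventually_optDiff_le_line (st : Station) {h W : ℝ} (hh : 0 < h) (hW : 0 ≤ W) :
    ∀ᶠ n in atTop, st.optDiff h W n ≤ st.line h W (st.optRate h W) n := by
  filter_upwards [(st.tendsto_line hh W (st.optRate h W)).eventually_ge_atTop 0] with n hn
  by_contra! hlt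
  have hcont : ContinuousAt (fun γ => st.biasDiff h W γ n - st.line h W γ n) (st.optRate h W) := by
    refine ((st.continuous_biasDiff h W n).sub ?_).continuousAt
    unfold line
    fun_prop
  -- the two conditions, stable under small changes of `γ`, that make `γ` feasible
  have ev1 : ∀ᶠ γ in 𝓝 (st.optRate h W), 0 < st.biasDiff h W γ n - st.line h W γ n :=
    hcont.eventually (lt_mem_nhds (sub_pos.2 hlt))
  have ev2 : ∀ᶠ γ in 𝓝 (st.optRate h W), ∀ m ∈ Finset.range n,
      0 < st.biasDiff h W γ (m + 1) :=
    (Finset.eventually_all _).2 fun m _ =>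
      (st.continuous_biasDiff h W (m + 1)).continuousAt.eventually
        (lt_mem_nhds (st.strictMono_optDiff hh hW m.succ_pos))
  obtain ⟨γ, ⟨hγ1, hγ2⟩, hγ⟩ :=
    (((ev1.and ev2).filter_mono nhdsWithin_le_nhds).and
      (self_mem_nhdsWithin (s := Iio (st.optRate h W)))).exists
  refine (csInf_le (st.bddBelow_feasibleRates (h := h) hW) (a := γ) fun m => ?_).not_gt hγ
  rcases le_total n m with hm | hm
  · refine le_trans ?_ (st.line_le_biasDiff (sub_pos.1 hγ1).le hm)
    refine hn.trans ?_
    have hs := mul_le_mul_of_nonneg_left (Nat.cast_le (α := ℝ).2 hm) (st.slope_nonneg hh.le)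
    have hd : (st.lam * st.slope h + W * st.S - st.optRate h W) / (st.mu st.S - st.lam) ≤
        (st.lam * st.slope h + W * st.S - γ) / (st.mu st.S - st.lam) :=
      div_le_div_of_nonneg_right (by linarith) (sub_pos.2 st.stable).le
    simp only [line]
    linarith
  · rcases m with _ | m
    · exact le_rfl
    · exact (hγ2 m (Finset.mem_range.2 hm)).le

/-- Where all servers are deployed, a deviation from the affine solution grows geometrically,
which is incompatible with the linear bounds. -/
theorem eventually_optDiff_eq_line (st : Station) {h W : ℝ} (hh : 0 < h) (hW : 0 ≤ W) :
    ∀ᶠ n in atTop, st.optDiff h W n = st.line h W (st.optRate h W) n := by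
  have hmu := st.lam_pos.trans st.stable
  obtain ⟨m, hm⟩ := eventually_atTop.1
    ((st.tendsto_optDiff hh hW).eventually (st.eventually_hamiltonian_eq W))
  set D : ℕ → ℝ := fun n => st.line h W (st.optRate h W) n - st.optDiff h W n with hD
  have hrec : ∀ n, m ≤ n → D (n + 1) = st.mu st.S / st.lam * D n := by
    intro n hn
    have h1 := st.lam_mul_optDiff_succ h W n
    have h2 := st.lam_mul_line_succ h W (st.optRate h W) n
    rw [hm n hn] at h1
    rw [div_mul_eq_mul_div, eq_div_iff st.lam_pos.ne']
    simp only [hD]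
    linarith
  filter_upwards [st.eventually_optDiff_le_line hh hW, eventually_ge_atTop m] with n hn hmn
  refine le_antisymm hn (not_lt.1 fun hlt => ?_)
  have hgeom : ∀ k, D (n + k) = (st.mu st.S / st.lam) ^ k * D n := by
    intro k
    induction k with
    | zero => simp
    | succ k ih => rw [← add_assoc, hrec _ (by omega), ih, pow_succ]; ring
  have hle : ∀ k : ℕ, (st.mu st.S / st.lam) ^ k * D n ≤
      st.slope h * k + st.line h W (st.optRate h W) n := by
    intro k
    rw [← hgeom]
    have := st.optDiff_nonneg hh.le hW (n + k)
    simp only [hD, line] at *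
    push_cast
    linarith
  have hr : 1 < st.mu st.S / st.lam := (one_lt_div st.lam_pos).2 st.stable
  have h1 := (tendsto_pow_const_div_const_pow_of_one_lt 1 hr).const_mul (st.slope h)
  have h2 := (tendsto_pow_const_div_const_pow_of_one_lt 0 hr).const_mul
    (st.line h W (st.optRate h W) n)
  have h3 := h1.add h2
  simp only [mul_zero, add_zero, pow_one, pow_zero] at h3
  refine (ge_of_tendsto h3 (Eventually.of_forall fun k => ?_)).not_gt (sub_pos.2 hlt)
  have hpos : 0 < (st.mu st.S / st.lam) ^ k := by positivity
  rw [mul_div_assoc', mul_div_assoc', ← add_div, mul_one, le_div_iff₀ hpos, mul_comm]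
  exact hle k

theorem optDiff_zero_holding (st : Station) {W : ℝ} (hW : 0 ≤ W) :
    st.optRate 0 W = 0 ∧ ∀ n, st.optDiff 0 W n = 0 := by
  have hz : ∀ n, st.biasDiff 0 W 0 n = 0 := by
    intro n
    induction n with
    | zero => rfl
    | succ n ih => rw [biasDiff, ih, st.hamiltonian_zero hW]; simp
  have h0 : st.optRate 0 W = 0 :=
    le_antisymm (csInf_le (st.bddBelow_feasibleRates hW) fun n => (hz n).ge)
      (st.optRate_nonneg le_rfl hW)
  exact ⟨h0, fun n => by rw [optDiff, h0, hz]⟩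

/-! ### Comparison of holding cost rates -/

/-- Once the bias difference for the larger holding cost falls to that for the smaller one while
the larger holding cost outweighs the larger cost rate, it stays below for ever, although it is
asymptotically steeper. -/
theorem not_optDiff_le (st : Station) {h h' W : ℝ} (hh : 0 ≤ h) (hlt : h < h') (hW : 0 ≤ W)
    {n : ℕ} (hn : st.optDiff h' W n ≤ st.optDiff h W n)
    (hrate : st.optRate h' W - h' * n ≤ st.optRate h W - h * n) : False := by
  have hh' : 0 < h' := hh.trans_lt hlt
  have key : ∀ m, n ≤ m → st.optDiff h' W m ≤ st.optDiff h W m := by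
    intro m hm
    induction m, hm using Nat.le_induction with
    | base => exact hn
    | succ m hm ih =>
      have h1 := st.lam_mul_optDiff_succ h W m
      have h2 := st.lam_mul_optDiff_succ h' W m
      have h3 := st.hamiltonian_antitone W ih
      have h4 := mul_le_mul_of_nonneg_left (Nat.cast_le (α := ℝ).2 hm) (sub_pos.2 hlt).le
      exact le_of_mul_le_mul_left (by linarith) st.lam_pos
  obtain ⟨C, hC⟩ : ∃ C : ℝ, ∀ᶠ m : ℕ in atTop, st.optDiff h W m ≤ st.slope h * m + C := by
    rcases hh.eq_or_lt with rfl | hpos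
    · exact ⟨0, Eventually.of_forall fun m => by
        simp [(st.optDiff_zero_holding hW).2 m, slope]⟩
    · exact ⟨_, (st.eventually_optDiff_eq_line hpos hW).mono fun m hm => hm.le⟩
  have hgap := tendsto_natCast_atTop_atTop.const_mul_atTop (sub_pos.2 (st.slope_lt_slope hlt))
  obtain ⟨m, h1, h2, h3, h4⟩ := (hC.and ((st.eventually_optDiff_eq_line hh' hW).and
    ((eventually_ge_atTop n).and (hgap.eventually_gt_atTop (C - (st.lam * st.slope h' +
      W * st.S - st.optRate h' W) / (st.mu st.S - st.lam)))))).exists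
  have h5 := key m h3
  rw [h2, line] at h5
  linarith

/-- The bias differences in nonempty states are strictly increasing in the holding cost. At the
first failure the holding cost outweighs the optimal rate, as `not_optDiff_le` requires. -/
theorem optDiff_lt_optDiff (st : Station) {h h' W : ℝ} (hh : 0 ≤ h) (hlt : h < h') (hW : 0 ≤ W)
    (n : ℕ) : st.optDiff h W (n + 1) < st.optDiff h' W (n + 1) := by
  have step : ∀ n, st.optDiff h W n ≤ st.optDiff h' W n →
      st.optDiff h W (n + 1) < st.optDiff h' W (n + 1) := by
    intro n hn
    by_contra! hle
    have h1 := st.lam_mul_optDiff_succ h W n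
    have h2 := st.lam_mul_optDiff_succ h' W n
    have h3 := st.hamiltonian_antitone W hn
    have h4 := mul_le_mul_of_nonneg_left hle st.lam_pos.le
    refine st.not_optDiff_le hh hlt hW hle ?_
    push_cast
    linarith
  induction n with
  | zero => exact step 0 le_rfl
  | succ n ih => exact step _ ih.le

theorem optDiff_mono_holding (st : Station) {h h' W : ℝ} (hh : 0 ≤ h) (hle : h ≤ h')
    (hW : 0 ≤ W) (n : ℕ) : st.optDiff h W n ≤ st.optDiff h' W n := by
  rcases hle.eq_or_lt with rfl | hlt
  · exact le_rfl
  · rcases n with _ | n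
    · exact le_rfl
    · exact (st.optDiff_lt_optDiff hh hlt hW n).le

/-! ### Expected cost along the uniformizing clock -/

theorem lintegral_stepLaw (st : Station) (u : st.Policy) (n : ℕ) (f : ℕ → ℝ≥0∞) :
    ∫⁻ m, f m ∂(st.stepLaw u n) =
      ENNReal.ofReal (st.lam / st.clockRate) * f (n + 1)
        + ENNReal.ofReal (st.mu (u n) / st.clockRate) * f (n - 1)
        + ENNReal.ofReal ((st.mu st.S - st.mu (u n)) / st.clockRate) * f n := by
  simp only [stepLaw, lintegral_add_measure, lintegral_smul_measure, lintegral_dirac, smul_eq_mul]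

/-- The mean increment of `w` over one tick, in terms of the differences of `w`; at the empty
state the void service contributes nothing because `diff w 0 = 0`. -/
theorem clockRate_mul_lintegral_stepLaw (st : Station) (u : st.Policy) (n : ℕ) {w : ℕ → ℝ}
    (hw : ∀ m, 0 ≤ w m) :
    ENNReal.ofReal st.clockRate * ∫⁻ m, ENNReal.ofReal (w m) ∂(st.stepLaw u n) =
      ENNReal.ofReal (st.clockRate * w n
        + (st.lam * diff w (n + 1) - st.mu (u n) * diff w n)) := by
  have hc := st.clockRate_pos
  have h0 := st.lam_pos
  have h1 := st.mu_nonneg (u n)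
  have h2 := sub_nonneg.2 (st.mu_le (Nat.lt_succ_iff.mp (u n).2) le_rfl)
  have e1 := hw (n + 1)
  have e2 := hw (n - 1)
  have e3 := hw n
  rw [lintegral_stepLaw, ← ENNReal.ofReal_mul (by positivity), ← ENNReal.ofReal_mul (by positivity),
    ← ENNReal.ofReal_mul (by positivity), ← ENNReal.ofReal_add (by positivity) (by positivity),
    ← ENNReal.ofReal_add (by positivity) (by positivity), ← ENNReal.ofReal_mul hc.le]
  congr 1
  have hd : diff w n = w n - w (n - 1) := by cases n <;> simp [diff]
  rw [hd, diff]
  field_simp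
  unfold clockRate
  ring

/-- The last of `k + 1` ticks can be split off instead of the first one. -/
theorem tickLaw_succ_last (st : Station) (u : st.Policy) (k n : ℕ) :
    st.tickLaw u (k + 1) n = (st.tickLaw u k n).bind (st.stepLaw u) := by
  induction k generalizing n with
  | zero =>
    simp only [tickLaw]
    rw [Measure.dirac_bind .of_discrete]
    exact Measure.bind_dirac
  | succ k ih =>
    rw [tickLaw]
    conv_rhs => rw [tickLaw]
    rw [Measure.bind_bind Measurable.of_discrete.aemeasurable
      Measurable.of_discrete.aemeasurable]
    congr 1
    exact funext fun m => ih m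

theorem lintegral_tickLaw_succ (st : Station) (u : st.Policy) (k n : ℕ) (f : ℕ → ℝ≥0∞) :
    ∫⁻ m, f m ∂(st.tickLaw u (k + 1) n) =
      ∫⁻ m, ∫⁻ j, f j ∂(st.stepLaw u m) ∂(st.tickLaw u k n) := by
  rw [tickLaw_succ_last, Measure.lintegral_bind Measurable.of_discrete.aemeasurable
    Measurable.of_discrete.aemeasurable]

/-- The probability that exactly `k` ticks of the clock occur during `[0, t]`. -/
noncomputable def tickProb (st : Station) (k : ℕ) (t : ℝ) : ℝ :=
  Real.exp (-(st.clockRate * t)) * (st.clockRate * t) ^ k / (k.factorial : ℝ)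

theorem tickProb_nonneg (st : Station) (k : ℕ) {t : ℝ} (ht : 0 ≤ t) : 0 ≤ st.tickProb k t := by
  have := st.clockRate_pos
  unfold tickProb
  positivity

theorem continuous_tickProb (st : Station) (k : ℕ) : Continuous (st.tickProb k) := by
  unfold tickProb
  fun_prop

theorem poissonMeasure_eq_tickProb (st : Station) (k : ℕ) {t : ℝ} (ht : 0 ≤ t) :
    poissonMeasure (st.clockRate * t).toNNReal {k} = ENNReal.ofReal (st.tickProb k t) := by
  rw [poissonMeasure_singleton, Real.coe_toNNReal _ (mul_nonneg st.clockRate_pos.le ht), tickProb]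

theorem tsum_ofReal_tickProb (st : Station) {t : ℝ} (ht : 0 ≤ t) :
    ∑' k, ENNReal.ofReal (st.tickProb k t) = 1 := by
  simp_rw [← st.poissonMeasure_eq_tickProb _ ht]
  simpa using (lintegral_countable' (μ := poissonMeasure (st.clockRate * t).toNNReal) 1).symm

theorem hasDerivAt_tickProb_zero (st : Station) (t : ℝ) :
    HasDerivAt (st.tickProb 0) (-(st.clockRate * st.tickProb 0 t)) t := by
  have h := ((hasDerivAt_id t).const_mul st.clockRate).neg.exp
  have heq : st.tickProb 0 = fun s => Real.exp (-(st.clockRate * s)) := by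
    funext s; simp [tickProb]
  rw [heq]
  refine h.congr_deriv ?_
  simp
  ring

theorem hasDerivAt_tickProb_succ (st : Station) (k : ℕ) (t : ℝ) :
    HasDerivAt (st.tickProb (k + 1))
      (st.clockRate * (st.tickProb k t - st.tickProb (k + 1) t)) t := by
  have hlin := (hasDerivAt_id t).const_mul st.clockRate
  have h := (hlin.neg.exp.mul (hlin.pow (k + 1))).div_const (((k + 1).factorial : ℕ) : ℝ)
  refine h.congr_deriv ?_
  have hk : (k.factorial : ℝ) ≠ 0 := by positivity
  simp only [id, tickProb, Nat.factorial_succ, Pi.pow_apply, Pi.neg_apply]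
  push_cast
  field_simp
  ring

/-- The expected time during `[0, T]` at which the clock has ticked exactly `k` times. -/
noncomputable def tickTime (st : Station) (k : ℕ) (T : ℝ) : ℝ≥0∞ :=
  ∫⁻ s in Ioc 0 T, ENNReal.ofReal (st.tickProb k s)

theorem tickTime_eq (st : Station) (k : ℕ) {T : ℝ} (hT : 0 ≤ T) :
    st.tickTime k T = ENNReal.ofReal (∫ s in (0 : ℝ)..T, st.tickProb k s) := by
  rw [intervalIntegral.integral_of_le hT, tickTime, ofReal_integral_eq_lintegral_ofReal]
  · exact (st.continuous_tickProb k).integrableOn_Ioc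
  · exact (ae_restrict_mem measurableSet_Ioc).mono fun s hs => st.tickProb_nonneg k hs.1.le

theorem clockRate_mul_tickTime_zero_le (st : Station) {T : ℝ} (hT : 0 ≤ T) :
    ENNReal.ofReal st.clockRate * st.tickTime 0 T ≤ 1 := by
  have h := intervalIntegral.integral_eq_sub_of_hasDerivAt (a := 0) (b := T)
    (fun t _ => st.hasDerivAt_tickProb_zero t)
    ((continuous_const.mul (st.continuous_tickProb 0)).neg.intervalIntegrable _ _)
  rw [intervalIntegral.integral_neg, intervalIntegral.integral_const_mul] at h
  have h0 : st.tickProb 0 0 = 1 := by simp [tickProb]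
  have h1 := st.tickProb_nonneg 0 hT
  rw [st.tickTime_eq 0 hT, ← ENNReal.ofReal_mul st.clockRate_pos.le, ENNReal.ofReal_le_one]
  linarith

/-- Integrated form of the Poisson forward equation: the clock leaves the count `k` for `k + 1`,
and the difference of the occupation times is the mass at `k + 1` at the end. -/
theorem clockRate_mul_tickTime (st : Station) (k : ℕ) {T : ℝ} (hT : 0 ≤ T) :
    ENNReal.ofReal st.clockRate * st.tickTime k T =
      ENNReal.ofReal st.clockRate * st.tickTime (k + 1) T
        + ENNReal.ofReal (st.tickProb (k + 1) T) := by
  have h := intervalIntegral.integral_eq_sub_of_hasDerivAt (a := 0) (b := T)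
    (fun t _ => st.hasDerivAt_tickProb_succ k t)
    ((continuous_const.mul ((st.continuous_tickProb k).sub
      (st.continuous_tickProb (k + 1)))).intervalIntegrable _ _)
  rw [intervalIntegral.integral_const_mul, intervalIntegral.integral_sub
    ((st.continuous_tickProb k).intervalIntegrable _ _)
    ((st.continuous_tickProb (k + 1)).intervalIntegrable _ _)] at h
  have h0 : st.tickProb (k + 1) 0 = 0 := by simp [tickProb]
  have hc := st.clockRate_pos.le
  rw [st.tickTime_eq k hT, st.tickTime_eq (k + 1) hT, ← ENNReal.ofReal_mul hc,
    ← ENNReal.ofReal_mul hc, ← ENNReal.ofReal_add _ (st.tickProb_nonneg _ hT)]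
  · congr 1; linarith
  · exact mul_nonneg hc (intervalIntegral.integral_nonneg hT fun s hs =>
      st.tickProb_nonneg _ hs.1)

theorem tickTime_antitone (st : Station) (k : ℕ) {T : ℝ} (hT : 0 ≤ T) :
    st.tickTime (k + 1) T ≤ st.tickTime k T := by
  have hc : ENNReal.ofReal st.clockRate ≠ 0 := by simpa using st.clockRate_pos
  rw [← ENNReal.mul_le_mul_iff_right hc ENNReal.ofReal_ne_top, st.clockRate_mul_tickTime k hT]
  exact le_self_add

/-- The cost over `[0, T]` is the cost per tick weighted by the time spent at each tick count. -/
theorem lintegral_lintegral_law (st : Station) (u : st.Policy) (n : ℕ) (g : ℕ → ℝ≥0∞) (T : ℝ) :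
    ∫⁻ s in Ioc 0 T, ∫⁻ m, g m ∂(st.law u n s) =
      ∑' k, st.tickTime k T * ∫⁻ m, g m ∂(st.tickLaw u k n) := by
  have h : ∀ s ∈ Ioc 0 T, ∫⁻ m, g m ∂(st.law u n s) =
      ∑' k, ENNReal.ofReal (st.tickProb k s) * ∫⁻ m, g m ∂(st.tickLaw u k n) := by
    intro s hs
    rw [law, Measure.lintegral_bind Measurable.of_discrete.aemeasurable
      Measurable.of_discrete.aemeasurable, lintegral_countable']
    refine tsum_congr fun k => ?_
    rw [st.poissonMeasure_eq_tickProb k hs.1.le, mul_comm]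
  have hm : ∀ k, Measurable fun s => ENNReal.ofReal (st.tickProb k s) := fun k =>
    (st.continuous_tickProb k).measurable.ennreal_ofReal
  rw [setLIntegral_congr_fun measurableSet_Ioc h,
    lintegral_tsum fun k => ((hm k).mul_const _).aemeasurable]
  exact tsum_congr fun k => lintegral_mul_const _ (hm k)

theorem tsum_tickTime (st : Station) (T : ℝ) : ∑' k, st.tickTime k T = ENNReal.ofReal T := by
  have h := lintegral_tsum (μ := volume.restrict (Ioc 0 T))
    fun k => (st.continuous_tickProb k).measurable.ennreal_ofReal.aemeasurable
  unfold tickTime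
  rw [← h, setLIntegral_congr_fun measurableSet_Ioc
    fun s hs => st.tsum_ofReal_tickProb hs.1.le]
  simp

/-- Dynkin bound for a nonnegative supersolution `f` with cost rate `γ`. -/
theorem lintegral_cost_le (st : Station) (u : st.Policy) (n : ℕ) {f g : ℕ → ℝ≥0∞} {γ : ℝ≥0∞}
    (hγ : γ ≠ ∞) (hf : f n ≠ ∞)
    (hstep : ∀ m, ENNReal.ofReal st.clockRate * ∫⁻ j, f j ∂(st.stepLaw u m) + g m ≤
      ENNReal.ofReal st.clockRate * f m + γ) {T : ℝ} (hT : 0 ≤ T) :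
    ∫⁻ s in Ioc 0 T, ∫⁻ m, g m ∂(st.law u n s) ≤ γ * ENNReal.ofReal T + f n := by
  set c := ENNReal.ofReal st.clockRate with hc
  have hc0 : c ≠ 0 := by simpa [hc] using st.clockRate_pos
  have hct : c ≠ ∞ := ENNReal.ofReal_ne_top
  set a : ℕ → ℝ≥0∞ := fun k => ∫⁻ m, f m ∂(st.tickLaw u k n) with ha
  set b : ℕ → ℝ≥0∞ := fun k => ∫⁻ m, g m ∂(st.tickLaw u k n) with hb
  set q : ℕ → ℝ≥0∞ := fun k => st.tickTime k T with hq
  have hab : ∀ k, c * a (k + 1) + b k ≤ c * a k + γ := by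
    intro k
    simp only [ha, hb, lintegral_tickLaw_succ]
    rw [← lintegral_const_mul c .of_discrete, ← lintegral_add_left .of_discrete,
      ← lintegral_const_mul c .of_discrete]
    calc _ ≤ ∫⁻ m, (c * f m + γ) ∂(st.tickLaw u k n) := lintegral_mono hstep
      _ = _ := by rw [lintegral_add_left .of_discrete]; simp
  have ha0 : a 0 = f n := by simp [ha, tickLaw]
  have hafin : ∀ k, a k ≠ ∞ := by
    intro k
    induction k with
    | zero => rwa [ha0]
    | succ k ih =>
      have h1 : c * a (k + 1) ≠ ∞ := ne_top_of_le_ne_top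
        (ENNReal.add_ne_top.2 ⟨ENNReal.mul_ne_top hct ih, hγ⟩) (le_self_add.trans (hab k))
      exact fun h => h1 (by rw [h, ENNReal.mul_top hc0])
  have hqfin : ∀ k, q k ≠ ∞ := fun k => by
    simp only [hq, st.tickTime_eq k hT]; exact ENNReal.ofReal_ne_top
  rw [st.lintegral_lintegral_law]
  -- partial sums are finite, which permits the cancellation at the end
  refine ENNReal.tsum_le_of_sum_range_le fun K => ?_
  have hshift : ∑ k ∈ Finset.range K, q k * (c * a k) ≤
      (∑ k ∈ Finset.range K, q k * (c * a (k + 1))) + f n := by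
    calc ∑ k ∈ Finset.range K, q k * (c * a k)
        ≤ ∑ k ∈ Finset.range (K + 1), q k * (c * a k) :=
          Finset.sum_le_sum_of_subset (Finset.range_subset_range.2 K.le_succ)
      _ = (∑ k ∈ Finset.range K, q (k + 1) * (c * a (k + 1))) + q 0 * (c * a 0) :=
          Finset.sum_range_succ' _ _
      _ ≤ _ := by
          refine add_le_add (Finset.sum_le_sum fun k _ => ?_) ?_
          · gcongr; exact st.tickTime_antitone k hT
          · rw [ha0, ← mul_assoc, mul_comm (q 0)]
            exact mul_le_of_le_one_left' (st.clockRate_mul_tickTime_zero_le hT)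
  have hmain : (∑ k ∈ Finset.range K, q k * (c * a (k + 1))) + ∑ k ∈ Finset.range K, q k * b k ≤
      (∑ k ∈ Finset.range K, q k * (c * a (k + 1))) + (γ * ENNReal.ofReal T + f n) := by
    calc _ = ∑ k ∈ Finset.range K, q k * (c * a (k + 1) + b k) := by
          rw [← Finset.sum_add_distrib]; simp only [mul_add]
      _ ≤ ∑ k ∈ Finset.range K, q k * (c * a k + γ) :=
          Finset.sum_le_sum fun k _ => mul_le_mul_right (hab k) _
      _ = (∑ k ∈ Finset.range K, q k * (c * a k)) + γ * ∑ k ∈ Finset.range K, q k := by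
          rw [Finset.mul_sum, ← Finset.sum_add_distrib]
          exact Finset.sum_congr rfl fun k _ => by rw [mul_add, mul_comm γ]
      _ ≤ ((∑ k ∈ Finset.range K, q k * (c * a (k + 1))) + f n) + γ * ENNReal.ofReal T := by
          gcongr
          rw [← st.tsum_tickTime T]
          exact ENNReal.sum_le_tsum _
      _ = _ := by ring
  refine (ENNReal.add_le_add_iff_left ?_).1 hmain
  exact ENNReal.sum_ne_top.2 fun k _ =>
    ENNReal.mul_ne_top (hqfin k) (ENNReal.mul_ne_top hct (hafin _))

/-- Dynkin bound for a bounded nonnegative subsolution `f` with cost rate `γ`. -/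
theorem le_lintegral_cost (st : Station) (u : st.Policy) (n : ℕ) {f g : ℕ → ℝ≥0∞}
    {γ B : ℝ≥0∞} (hB : B ≠ ∞) (hf : ∀ m, f m ≤ B)
    (hstep : ∀ m, ENNReal.ofReal st.clockRate * f m + γ ≤
      ENNReal.ofReal st.clockRate * ∫⁻ j, f j ∂(st.stepLaw u m) + g m) {T : ℝ} (hT : 0 ≤ T) :
    γ * ENNReal.ofReal T ≤ (∫⁻ s in Ioc 0 T, ∫⁻ m, g m ∂(st.law u n s)) + B := by
  set c := ENNReal.ofReal st.clockRate with hc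
  have hct : c ≠ ∞ := ENNReal.ofReal_ne_top
  set a : ℕ → ℝ≥0∞ := fun k => ∫⁻ m, f m ∂(st.tickLaw u k n) with ha
  set b : ℕ → ℝ≥0∞ := fun k => ∫⁻ m, g m ∂(st.tickLaw u k n) with hb
  set q : ℕ → ℝ≥0∞ := fun k => st.tickTime k T with hq
  have hab : ∀ k, c * a k + γ ≤ c * a (k + 1) + b k := by
    intro k
    simp only [ha, hb, lintegral_tickLaw_succ]
    rw [← lintegral_const_mul c .of_discrete, ← lintegral_const_mul c .of_discrete,
      ← lintegral_add_left .of_discrete]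
    calc _ = ∫⁻ m, (c * f m + γ) ∂(st.tickLaw u k n) := by
          rw [lintegral_add_left .of_discrete]; simp
      _ ≤ _ := lintegral_mono hstep
  have haB : ∀ k, a k ≤ B := fun k => by
    calc a k ≤ ∫⁻ _, B ∂(st.tickLaw u k n) := lintegral_mono hf
      _ = B := by simp
  have hqT : ∑' k, q k = ENNReal.ofReal T := st.tsum_tickTime T
  rw [st.lintegral_lintegral_law]
  have hshift : ∑' k, q k * (c * a (k + 1)) ≤ ∑' k, q k * (c * a k) + B := by
    calc ∑' k, q k * (c * a (k + 1))
        = ∑' k, (q (k + 1) * (c * a (k + 1))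
            + ENNReal.ofReal (st.tickProb (k + 1) T) * a (k + 1)) := by
          refine tsum_congr fun k => ?_
          rw [← mul_assoc, mul_comm (q k), st.clockRate_mul_tickTime k hT]
          ring
      _ = ∑' k, q (k + 1) * (c * a (k + 1))
            + ∑' k, ENNReal.ofReal (st.tickProb (k + 1) T) * a (k + 1) := ENNReal.tsum_add
      _ ≤ ∑' k, q k * (c * a k) + ∑' k, ENNReal.ofReal (st.tickProb k T) * a k :=
          add_le_add
            (ENNReal.tsum_comp_le_tsum_of_injective (add_left_injective 1)
              fun k => q k * (c * a k))
            (ENNReal.tsum_comp_le_tsum_of_injective (add_left_injective 1)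
              fun k => ENNReal.ofReal (st.tickProb k T) * a k)
      _ ≤ ∑' k, q k * (c * a k) + B := by
          gcongr
          calc _ ≤ ∑' k, ENNReal.ofReal (st.tickProb k T) * B :=
                ENNReal.tsum_le_tsum fun k => by gcongr; exact haB k
            _ = B := by rw [ENNReal.tsum_mul_right, st.tsum_ofReal_tickProb hT, one_mul]
  have hmain : ∑' k, q k * (c * a k) + γ * ENNReal.ofReal T ≤
      ∑' k, q k * (c * a k) + (∑' k, q k * b k + B) := by
    calc _ = ∑' k, q k * (c * a k + γ) := by
          rw [← hqT, ← ENNReal.tsum_mul_left, ← ENNReal.tsum_add]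
          exact tsum_congr fun k => by ring
      _ ≤ ∑' k, q k * (c * a (k + 1) + b k) :=
          ENNReal.tsum_le_tsum fun k => mul_le_mul_right (hab k) _
      _ = ∑' k, q k * (c * a (k + 1)) + ∑' k, q k * b k := by
          rw [← ENNReal.tsum_add]; simp only [mul_add]
      _ ≤ (∑' k, q k * (c * a k) + B) + ∑' k, q k * b k := by gcongr
      _ = _ := by ring
  refine (ENNReal.add_le_add_iff_left ?_).1 hmain
  refine ne_top_of_le_ne_top (b := ∑' k, q k * (c * B)) ?_
    (ENNReal.tsum_le_tsum fun k => by gcongr; exact haB k)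
  rw [ENNReal.tsum_mul_right, hqT]
  exact ENNReal.mul_ne_top ENNReal.ofReal_ne_top (ENNReal.mul_ne_top hct hB)

/-! ### Average cost bounds -/

theorem tendsto_div_ofReal {B : ℝ≥0∞} (hB : B ≠ ∞) :
    Tendsto (fun T : ℝ => B / ENNReal.ofReal T) atTop (𝓝 0) := by
  simpa using ENNReal.Tendsto.const_div ENNReal.tendsto_ofReal_atTop (Or.inr hB)

theorem avgCost_le_of_supersolution (st : Station) {h W : ℝ} (u : st.Policy) (n : ℕ)
    {f : ℕ → ℝ≥0∞} {γ : ℝ≥0∞} (hγ : γ ≠ ∞) (hf : f n ≠ ∞)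
    (hstep : ∀ m, ENNReal.ofReal st.clockRate * ∫⁻ j, f j ∂(st.stepLaw u m)
      + st.costRate h W u m ≤ ENNReal.ofReal st.clockRate * f m + γ) :
    st.avgCost h W u n ≤ γ := by
  have hlim : Tendsto (fun T : ℝ => γ + f n / ENNReal.ofReal T) atTop (𝓝 γ) := by
    simpa using (tendsto_div_ofReal hf).const_add γ
  rw [← hlim.liminf_eq, avgCost]
  refine liminf_le_liminf ?_
  filter_upwards [eventually_gt_atTop 0] with T hT
  have hT0 : ENNReal.ofReal T ≠ 0 := by simpa using hT
  have h1 := st.lintegral_cost_le u n hγ hf hstep hT.le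
  calc _ ≤ (γ * ENNReal.ofReal T + f n) / ENNReal.ofReal T := ENNReal.div_le_div_right h1 _
    _ = γ + f n / ENNReal.ofReal T := by
      rw [ENNReal.add_div, ENNReal.mul_div_cancel_right hT0 ENNReal.ofReal_ne_top]

theorem le_avgCost_of_subsolution (st : Station) {h W : ℝ} (u : st.Policy) (n : ℕ)
    {f : ℕ → ℝ≥0∞} {γ B : ℝ≥0∞} (hγ : γ ≠ ∞) (hB : B ≠ ∞) (hf : ∀ m, f m ≤ B)
    (hstep : ∀ m, ENNReal.ofReal st.clockRate * f m + γ ≤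
      ENNReal.ofReal st.clockRate * ∫⁻ j, f j ∂(st.stepLaw u m) + st.costRate h W u m) :
    γ ≤ st.avgCost h W u n := by
  have hlim : Tendsto (fun T : ℝ => γ - B / ENNReal.ofReal T) atTop (𝓝 γ) := by
    simpa using ENNReal.Tendsto.sub (tendsto_const_nhds (x := γ)) (tendsto_div_ofReal hB)
      (Or.inl hγ)
  rw [← hlim.liminf_eq, avgCost]
  refine liminf_le_liminf ?_
  filter_upwards [eventually_gt_atTop 0] with T hT
  have hT0 : ENNReal.ofReal T ≠ 0 := by simpa using hT
  have h1 := st.le_lintegral_cost u n hB hf hstep hT.le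
  rw [tsub_le_iff_right, ← ENNReal.add_div]
  exact (ENNReal.le_div_iff_mul_le (Or.inl hT0) (Or.inl ENNReal.ofReal_ne_top)).2 h1

/-! ### Verification of the optimality equations -/

/-- The function with value `0` at `0` and differences `y 1, y 2, …`. -/
noncomputable def partialSum (y : ℕ → ℝ) (n : ℕ) : ℝ := ∑ i ∈ Finset.range n, y (i + 1)

theorem diff_partialSum {y : ℕ → ℝ} (hy : y 0 = 0) (n : ℕ) : diff (partialSum y) n = y n := by
  cases n with
  | zero => exact hy.symm
  | succ n => simp [diff, partialSum, Finset.sum_range_succ]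

theorem partialSum_nonneg {y : ℕ → ℝ} (hy : ∀ n, 0 ≤ y n) (n : ℕ) : 0 ≤ partialSum y n :=
  Finset.sum_nonneg fun _ _ => hy _

theorem eq_partialSum_diff {v : ℕ → ℝ} (hv : v 0 = 0) : v = partialSum (diff v) := by
  funext n
  induction n with
  | zero => simp [partialSum, hv]
  | succ n ih =>
    rw [partialSum, Finset.sum_range_succ, ← partialSum, ← ih, diff]; ring

/-- The policy minimizing the right-hand side of the optimality equations in each state, with as
few servers as possible. -/
noncomputable def greedyPolicy (st : Station) (h W : ℝ) : st.Policy :=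
  fun n => st.greedy W (st.optDiff h W n)

/-- The partial sums of the optimal bias differences are nonnegative and solve the evaluation
equations of the greedy policy, so they form a supersolution. -/
theorem avgCost_greedyPolicy_le (st : Station) {h W : ℝ} (hh : 0 ≤ h) (hW : 0 ≤ W) (n : ℕ) :
    st.avgCost h W (st.greedyPolicy h W) n ≤ ENNReal.ofReal (st.optRate h W) := by
  have hx := st.optDiff_nonneg hh hW
  have hv := partialSum_nonneg hx
  have hc := st.clockRate_pos
  refine st.avgCost_le_of_supersolution _ n
    (f := fun m => ENNReal.ofReal (partialSum (st.optDiff h W) m))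
    ENNReal.ofReal_ne_top ENNReal.ofReal_ne_top fun m => ?_
  have hm := st.mu_nonneg (st.greedyPolicy h W m)
  have hm' : st.mu (st.greedyPolicy h W m) ≤ st.clockRate :=
    (st.mu_le (Nat.lt_succ_iff.mp (st.greedyPolicy h W m).2) le_rfl).trans
      (le_add_of_nonneg_left st.lam_pos.le)
  -- needed only because `ENNReal.ofReal` truncates negative numbers
  have hle : st.optDiff h W m ≤ partialSum (st.optDiff h W) m := by
    cases m with
    | zero => exact le_rfl
    | succ m =>
      rw [partialSum, Finset.sum_range_succ]
      exact le_add_of_nonneg_left (partialSum_nonneg hx m)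
  have h1 := mul_le_mul hm' hle (hx m) hc.le
  have h2 := mul_nonneg st.lam_pos.le (hx (m + 1))
  have h3 := st.lam_mul_optDiff_succ h W m
  have h4 := st.greedy_spec W (st.optDiff h W m)
  rw [st.clockRate_mul_lintegral_stepLaw _ _ hv, diff_partialSum rfl, diff_partialSum rfl,
    costRate, ← ENNReal.ofReal_mul hc.le,
    ← ENNReal.ofReal_add (by linarith) (by positivity),
    ← ENNReal.ofReal_add (mul_nonneg hc.le (hv m)) (st.optRate_nonneg hh hW)]
  refine ENNReal.ofReal_le_ofReal ?_
  simp only [greedyPolicy] at *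
  linarith

/-- A truncation of `θ * x`: from the state `N` on it decreases to `0` with slope `1`. Its partial
sums are bounded, so that Dynkin's formula needs no moment bounds on the head count. -/
noncomputable def ramp (θ : ℝ) (x : ℕ → ℝ) (N n : ℕ) : ℝ :=
  if n ≤ N then θ * x n else max 0 (θ * x N - ((n : ℝ) - N))

theorem ramp_nonneg {θ : ℝ} {x : ℕ → ℝ} (hθ : 0 ≤ θ) (hx : ∀ n, 0 ≤ x n) (N n : ℕ) :
    0 ≤ ramp θ x N n := by
  unfold ramp
  split_ifs
  · exact mul_nonneg hθ (hx n)
  · exact le_max_left _ _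

theorem ramp_of_ge {θ : ℝ} {x : ℕ → ℝ} (hθ : 0 ≤ θ) (hx : ∀ n, 0 ≤ x n) {N n : ℕ}
    (hn : N ≤ n) : ramp θ x N n = max 0 (θ * x N - ((n : ℝ) - N)) := by
  rcases hn.eq_or_lt with rfl | hlt
  · simp [ramp, mul_nonneg hθ (hx N)]
  · simp [ramp, hlt]

theorem exists_partialSum_ramp_le {θ : ℝ} {x : ℕ → ℝ} (hθ : 0 ≤ θ) (hx : ∀ n, 0 ≤ x n) (N : ℕ) :
    ∃ B : ℝ, ∀ n, partialSum (ramp θ x N) n ≤ B := by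
  obtain ⟨K, hK⟩ := exists_nat_ge (θ * x N)
  refine ⟨partialSum (ramp θ x N) (N + K), fun n => ?_⟩
  have hr := ramp_nonneg hθ hx N
  have hmono : Monotone (partialSum (ramp θ x N)) := monotone_nat_of_le_succ fun n => by
    simp only [partialSum]
    rw [Finset.sum_range_succ]
    exact le_add_of_nonneg_right (hr _)
  rcases le_total n (N + K) with hn | hn
  · exact hmono hn
  · refine le_of_eq (Finset.sum_subset (Finset.range_subset_range.2 hn) fun i _ hi => ?_).symm
    rw [Finset.mem_range, not_lt] at hi
    rw [ramp_of_ge hθ hx (by omega), max_eq_left]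
    have : ((N + K : ℕ) : ℝ) ≤ i := by exact_mod_cast hi
    push_cast at this ⊢
    linarith

/-- Beyond a late state `N` the holding cost alone pays for the slope of the ramp, because the
factor `θ` leaves a slack `(1 - θ) * h * N`. -/
theorem exists_ramp_subsolution (st : Station) {h W θ : ℝ} (hh : 0 < h) (hW : 0 ≤ W)
    (hθ0 : 0 ≤ θ) (hθ1 : θ < 1) : ∃ N : ℕ, ∀ n : ℕ,
      θ * st.optRate h W ≤ h * n + st.lam * ramp θ (st.optDiff h W) N (n + 1)
        + st.hamiltonian W (ramp θ (st.optDiff h W) N n) := by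
  set x := st.optDiff h W with hx
  have hx0 : ∀ n, 0 ≤ x n := st.optDiff_nonneg hh.le hW
  have hγ := st.optRate_nonneg hh.le hW
  have hlam := st.lam_pos
  have hlarge : Tendsto (fun N : ℕ => h * (1 - θ) * (N : ℝ)) atTop atTop :=
    tendsto_natCast_atTop_atTop.const_mul_atTop (mul_pos hh (sub_pos.2 hθ1))
  obtain ⟨N₀, hN₀⟩ := eventually_atTop.1 (st.eventually_optDiff_eq_line hh hW)
  obtain ⟨N, hN1, hN2, hN3⟩ := ((hlarge.eventually_ge_atTop
    (st.optRate h W + st.lam + st.lam * st.slope h)).and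
    ((eventually_ge_atTop N₀).and (eventually_gt_atTop 0))).exists
  have hxN : 0 < x N := st.strictMono_optDiff hh hW hN3
  have hstep : x (N + 1) = x N + st.slope h := by
    rw [hx, hN₀ N hN2, hN₀ (N + 1) (by omega), line_succ]
  refine ⟨N, fun n => ?_⟩
  rcases lt_or_ge n N with hn | hn
  · have h1 := st.lam_mul_optDiff_succ h W n
    have h2 := st.mul_hamiltonian_le hW hθ0 hθ1.le (x n)
    have h3 : 0 ≤ (1 - θ) * (h * n) := by
      have := sub_pos.2 hθ1
      positivity
    simp only [ramp, hn.le, Nat.succ_le_of_lt hn, if_true]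
    rw [← hx] at h1
    linear_combination h2 + h3 - θ * h1
  · set y := ramp θ x N n with hy
    have hy0 : 0 ≤ y := ramp_nonneg hθ0 hx0 N n
    have hyN : y ≤ θ * x N := by
      rw [hy, ramp_of_ge hθ0 hx0 hn]
      have : (N : ℝ) ≤ n := by exact_mod_cast hn
      exact max_le (mul_nonneg hθ0 hxN.le) (by linarith)
    have hnext : y - 1 ≤ ramp θ x N (n + 1) := by
      rw [hy, ramp_of_ge hθ0 hx0 hn, ramp_of_ge hθ0 hx0 (hn.trans n.le_succ)]
      push_cast
      rcases max_cases (0 : ℝ) (θ * x N - ((n : ℝ) - N)) with ⟨h1, -⟩ | ⟨h1, -⟩ <;> rw [h1]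
      · exact le_max_of_le_left (by norm_num)
      · exact le_max_of_le_right (by linarith)
    -- concavity of the Hamiltonian compares the ramp at `n` with `x N`, where the recursion applies
    obtain ⟨t, ht0, htθ, hty⟩ : ∃ t, 0 ≤ t ∧ t ≤ θ ∧ y = t * x N :=
      ⟨y / x N, div_nonneg hy0 hxN.le, (div_le_iff₀ hxN).2 hyN, (div_mul_cancel₀ _ hxN.ne').symm⟩
    have h1 := st.lam_mul_optDiff_succ h W N
    rw [← hx, hstep] at h1
    have h2 := st.mul_hamiltonian_le hW ht0 (htθ.trans hθ1.le) (x N)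
    rw [← hty] at h2
    have h3 := mul_le_mul_of_nonneg_left hnext hlam.le
    have h4 : h * (N : ℝ) ≤ h * n := by
      have : (N : ℝ) ≤ n := by exact_mod_cast hn
      gcongr
    have h5 : 0 ≤ (θ - t) * (h * N) := mul_nonneg (sub_nonneg.2 htθ) (by positivity)
    have h6 : 0 ≤ (1 - t) * (st.lam * st.slope h) :=
      mul_nonneg (by linarith) (mul_nonneg hlam.le (st.slope_nonneg hh.le))
    have h7 : 0 ≤ t * st.optRate h W := mul_nonneg ht0 hγ
    have h8 : 0 ≤ (1 - θ) * st.optRate h W := mul_nonneg (by linarith) hγ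
    have h9 : st.lam * y = t * (st.lam * x N) := by rw [hty]; ring
    have h10 : t * st.hamiltonian W (x N) + t * (st.lam * x N) =
        t * (st.optRate h W - h * N - st.lam * st.slope h) := by
      linear_combination t * h1
    linarith

/-- No policy beats the optimal rate: the ramps are bounded subsolutions with rate
`θ * optRate` for every `θ < 1`. -/
theorem optRate_le_avgCost (st : Station) {h W : ℝ} (hh : 0 ≤ h) (hW : 0 ≤ W) (u : st.Policy)
    (n : ℕ) : ENNReal.ofReal (st.optRate h W) ≤ st.avgCost h W u n := by
  rcases hh.eq_or_lt with rfl | hpos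
  · simp [(st.optDiff_zero_holding hW).1]
  have hlim : Tendsto (fun θ : ℝ => ENNReal.ofReal (θ * st.optRate h W)) (𝓝[<] 1)
      (𝓝 (ENNReal.ofReal (st.optRate h W))) := by
    have : Continuous fun θ : ℝ => ENNReal.ofReal (θ * st.optRate h W) :=
      ENNReal.continuous_ofReal.comp (continuous_id.mul continuous_const)
    simpa using (this.tendsto 1).mono_left nhdsWithin_le_nhds
  refine le_of_tendsto hlim ?_
  filter_upwards [self_mem_nhdsWithin, nhdsWithin_le_nhds (lt_mem_nhds one_pos)] with θ hθ1 hθ0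
  have hx := st.optDiff_nonneg hh hW
  have hc := st.clockRate_pos
  obtain ⟨N, hN⟩ := st.exists_ramp_subsolution hpos hW hθ0.le hθ1
  obtain ⟨B, hB⟩ := exists_partialSum_ramp_le hθ0.le hx N
  have hy := ramp_nonneg hθ0.le hx N
  have hw := partialSum_nonneg hy
  have hr0 : ramp θ (st.optDiff h W) N 0 = 0 := by simp [ramp, optDiff_zero]
  refine st.le_avgCost_of_subsolution u n
    (f := fun m => ENNReal.ofReal (partialSum (ramp θ (st.optDiff h W) N) m))
    (B := ENNReal.ofReal B) ENNReal.ofReal_ne_top ENNReal.ofReal_ne_top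
    (fun m => ENNReal.ofReal_le_ofReal (hB m)) fun m => ?_
  have h1 := hN m
  have h2 := st.hamiltonian_le W (ramp θ (st.optDiff h W) N m) (u m)
  rw [st.clockRate_mul_lintegral_stepLaw _ _ hw, diff_partialSum hr0, diff_partialSum hr0,
    costRate, ← ENNReal.ofReal_mul hc.le,
    ← ENNReal.ofReal_add (mul_nonneg hc.le (hw m))
      (mul_nonneg hθ0.le (st.optRate_nonneg hh hW))]
  refine (ENNReal.ofReal_le_ofReal ?_).trans ENNReal.ofReal_add_le
  linarith

theorem minCost_eq (st : Station) {h W : ℝ} (hh : 0 ≤ h) (hW : 0 ≤ W) (n : ℕ) :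
    st.minCost h W n = ENNReal.ofReal (st.optRate h W) :=
  le_antisymm ((iInf_le _ _).trans (st.avgCost_greedyPolicy_le hh hW n))
    (le_iInf fun u => st.optRate_le_avgCost hh hW u n)

theorem isOptimal_greedyPolicy (st : Station) {h W : ℝ} (hh : 0 ≤ h) (hW : 0 ≤ W) :
    st.IsOptimal h W (st.greedyPolicy h W) := fun n =>
  le_antisymm ((st.avgCost_greedyPolicy_le hh hW n).trans (st.minCost_eq hh hW n).ge)
    (iInf_le _ _)

/-! ### The bias -/

theorem inf'_eq_hamiltonian (st : Station) (x : ℝ) :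
    Finset.univ.inf' Finset.univ_nonempty
      (fun a : Fin (st.S + 1) => ((a : ℕ) : ℝ) - st.mu a * x) = st.hamiltonian 1 x := by
  simp only [hamiltonian, one_mul]

/-- The optimality equations at successive states determine the bias differences once the cost
rate is known, and the latter is prescribed by `IsBias`. -/
theorem isBias_iff (st : Station) {h : ℝ} (hh : 0 ≤ h) {v : ℕ → ℝ} :
    st.IsBias h v ↔ v = partialSum (st.optDiff h 1) := by
  have hγ := st.optRate_nonneg hh zero_le_one
  constructor
  · rintro ⟨hv0, γ, hmin, heq⟩
    have hγ' : (γ : ℝ) = st.optRate h 1 := by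
      have h1 := hmin 0
      rw [st.minCost_eq hh zero_le_one] at h1
      rw [← ENNReal.coe_toReal, ← h1, ENNReal.toReal_ofReal hγ]
    have hdiff : diff v = st.optDiff h 1 := by
      funext n
      induction n with
      | zero => rfl
      | succ n ih =>
        have h1 := heq n
        have h2 := st.lam_mul_optDiff_succ h 1 n
        rw [st.inf'_eq_hamiltonian, ih, hγ'] at h1
        refine mul_left_cancel₀ st.lam_pos.ne' ?_
        rw [h2, diff]
        linarith
    rw [← hdiff]
    exact eq_partialSum_diff hv0
  · rintro rfl
    refine ⟨by simp [partialSum], (st.optRate h 1).toNNReal,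
      fun n => st.minCost_eq hh zero_le_one n, fun n => ?_⟩
    have h1 := diff_partialSum (st.optDiff_zero h 1) n
    have h2 := diff_partialSum (st.optDiff_zero h 1) (n + 1)
    have h3 := st.lam_mul_optDiff_succ h 1 n
    rw [st.inf'_eq_hamiltonian, h1, Real.coe_toNNReal _ hγ]
    rw [diff] at h2
    rw [← h2] at h3
    linarith

/-! ### Thresholds and indexability -/

/-- The largest state in which at most `a` servers are deployed, or `⊤` if there are arbitrarily
large ones. -/
noncomputable def threshold (st : Station) (a : ℕ) (u : st.Policy) : ℕ∞ :=
  ⨆ n ∈ {n : ℕ | (u n : ℕ) ≤ a}, (n : ℕ∞)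

theorem setOf_le_eq_threshold {st : Station} {u : st.Policy} (hu : Monotone u) (h0 : u 0 = 0)
    (a : ℕ) : {n : ℕ | (u n : ℕ) ≤ a} = {n : ℕ | (n : ℕ∞) ≤ st.threshold a u} := by
  refine Subset.antisymm (fun n hn => le_iSup₂ (f := fun (n : ℕ) _ => (n : ℕ∞)) n hn)
    fun n hn => ?_
  by_contra hlt
  rw [mem_ofPred_eq, not_le] at hlt
  rcases n with _ | n
  · rw [h0] at hlt
    exact absurd hlt (Nat.not_lt_zero _)
  · have hle : st.threshold a u ≤ (n : ℕ∞) := iSup₂_le fun m hm => by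
      by_contra! hnm
      exact absurd (hlt.trans_le ((Fin.le_def.1 (hu (Nat.cast_lt.1 hnm))).trans hm)) (lt_irrefl _)
    exact absurd (Nat.cast_le.1 (le_trans hn hle)) (Nat.not_succ_le_self n)

theorem threshold_anti {st : Station} {u u' : st.Policy} (huu' : ∀ n, u n ≤ u' n) (a : ℕ) :
    st.threshold a u' ≤ st.threshold a u :=
  biSup_mono fun n hn => (Fin.le_def.1 (huu' n)).trans hn

theorem greedyPolicy_zero (st : Station) (h : ℝ) {W : ℝ} (hW : 0 ≤ W) :
    st.greedyPolicy h W 0 = 0 :=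
  st.greedy_zero hW

theorem greedyPolicy_monotone (st : Station) {h W : ℝ} (hh : 0 ≤ h) (hW : 0 ≤ W) :
    Monotone (st.greedyPolicy h W) := by
  refine (st.greedy_monotone W).comp ?_
  rcases hh.eq_or_lt with rfl | hpos
  · intro m n _
    rw [(st.optDiff_zero_holding hW).2, (st.optDiff_zero_holding hW).2]
  · exact (st.strictMono_optDiff hpos hW).monotone

theorem greedyPolicy_mono_holding (st : Station) {h h' W : ℝ} (hh : 0 ≤ h) (hle : h ≤ h')
    (hW : 0 ≤ W) (n : ℕ) : st.greedyPolicy h W n ≤ st.greedyPolicy h' W n :=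
  st.greedy_monotone W (st.optDiff_mono_holding hh hle hW n)

theorem hamiltonian_mul (st : Station) {W : ℝ} (hW : 0 < W) (x : ℝ) :
    st.hamiltonian W (W * x) = W * st.hamiltonian 1 x := by
  refine le_antisymm ?_ (le_hamiltonian fun a => ?_)
  · rw [← st.greedy_spec 1 x]
    refine (st.hamiltonian_le W (W * x) (st.greedy 1 x)).trans_eq (by ring)
  · refine (mul_le_mul_of_nonneg_left (st.hamiltonian_le 1 x a) hW.le).trans_eq (by ring)

theorem greedy_mul (st : Station) {W : ℝ} (hW : 0 < W) (x : ℝ) :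
    st.greedy W (W * x) = st.greedy 1 x := by
  refine le_antisymm (greedy_le ?_) (greedy_le ?_)
  · rw [st.hamiltonian_mul hW, ← st.greedy_spec 1 x]; ring
  · have h1 := st.greedy_spec W (W * x)
    rw [st.hamiltonian_mul hW] at h1
    refine mul_left_cancel₀ hW.ne' ?_
    linarith

theorem biasDiff_mul (st : Station) (h : ℝ) {W : ℝ} (hW : 0 < W) (γ : ℝ) (n : ℕ) :
    st.biasDiff h W (W * γ) n = W * st.biasDiff (h / W) 1 γ n := by
  induction n with
  | zero => simp [biasDiff]
  | succ n ih =>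
    rw [biasDiff, biasDiff, ih, st.hamiltonian_mul hW]
    field_simp

theorem mul_mem_feasibleRates_iff (st : Station) (h : ℝ) {W : ℝ} (hW : 0 < W) (γ : ℝ) :
    W * γ ∈ st.feasibleRates h W ↔ γ ∈ st.feasibleRates (h / W) 1 := by
  simp only [feasibleRates, mem_ofPred_eq, st.biasDiff_mul h hW, mul_nonneg_iff_of_pos_left hW]

/-- Multiplying both cost coefficients by `W` multiplies the optimal rate by `W`. -/
theorem optRate_eq_mul (st : Station) {h W : ℝ} (hh : 0 ≤ h) (hW : 0 < W) :
    st.optRate h W = W * st.optRate (h / W) 1 := by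
  refine le_antisymm ?_ ?_
  · exact csInf_le (st.bddBelow_feasibleRates hW.le) ((st.mul_mem_feasibleRates_iff h hW _).2
      (st.optRate_mem (div_nonneg hh hW.le) zero_le_one))
  · have h1 : st.optRate h W / W ∈ st.feasibleRates (h / W) 1 := by
      rw [← st.mul_mem_feasibleRates_iff h hW, mul_div_cancel₀ _ hW.ne']
      exact st.optRate_mem hh hW.le
    rw [← le_div_iff₀' hW]
    exact csInf_le (st.bddBelow_feasibleRates zero_le_one) h1

/-- Only the ratio of the holding cost rate to the server charge matters for the policy. -/
theorem greedyPolicy_eq_div (st : Station) {h W : ℝ} (hh : 0 ≤ h) (hW : 0 < W) :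
    st.greedyPolicy h W = st.greedyPolicy (h / W) 1 := by
  funext n
  rw [greedyPolicy, greedyPolicy, optDiff, st.optRate_eq_mul hh hW, st.biasDiff_mul h hW,
    st.greedy_mul hW, optDiff]

/-- For positive charges, raising the charge amounts to lowering the holding cost; at charge `0`
all servers are deployed in every nonempty state. -/
theorem greedyPolicy_anti_charge (st : Station) {h W W' : ℝ} (hh : 0 < h) (hW : 0 ≤ W)
    (hle : W ≤ W') (n : ℕ) : st.greedyPolicy h W' n ≤ st.greedyPolicy h W n := by
  rcases hW.eq_or_lt with rfl | hpos
  · rcases n with _ | n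
    · rw [st.greedyPolicy_zero h hle]
      exact Fin.zero_le _
    · have hlast : st.greedyPolicy h 0 (n + 1) = Fin.last st.S :=
        st.greedy_zero_charge (st.strictMono_optDiff hh le_rfl n.succ_pos)
      rw [hlast]
      exact Fin.le_last _
  · rw [st.greedyPolicy_eq_div hh.le hpos, st.greedyPolicy_eq_div hh.le (hpos.trans_le hle)]
    exact st.greedyPolicy_mono_holding (div_nonneg hh.le (hpos.trans_le hle).le)
      (div_le_div_of_nonneg_left hh.le hpos hle) zero_le_one n

theorem fullyIndexableInHolding (st : Station) : st.FullyIndexableInHolding :=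
  ⟨fun h => st.greedyPolicy h 1, fun a h => st.threshold a (st.greedyPolicy h 1),
    fun _ hh => ⟨st.isOptimal_greedyPolicy hh zero_le_one,
      st.greedyPolicy_monotone hh zero_le_one,
      fun a _ => setOf_le_eq_threshold (st.greedyPolicy_monotone hh zero_le_one)
        (st.greedyPolicy_zero _ zero_le_one) a⟩,
    fun a _ _ hh _ _ hle => threshold_anti (st.greedyPolicy_mono_holding hh hle zero_le_one) a⟩

theorem fullyIndexableInCharge (st : Station) {h : ℝ} (hh : 0 < h) :
    st.FullyIndexableInCharge h :=
  ⟨fun W => st.greedyPolicy h W, fun a W => st.threshold a (st.greedyPolicy h W),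
    fun _ hW => ⟨st.isOptimal_greedyPolicy hh.le hW, st.greedyPolicy_monotone hh.le hW,
      fun a _ => setOf_le_eq_threshold (st.greedyPolicy_monotone hh.le hW)
        (st.greedyPolicy_zero _ hW) a⟩,
    fun a _ _ hW _ _ hle => threshold_anti (st.greedyPolicy_anti_charge hh hW hle) a⟩

end Station

theorem theorem9 (st : Station) :
    (∀ h : ℝ, 0 ≤ h → ∃! v : ℕ → ℝ, st.IsBias h v) ∧
    (∀ v : ℝ → ℕ → ℝ, (∀ h : ℝ, 0 ≤ h → st.IsBias h (v h)) →
      ∀ n : ℕ, 1 ≤ n → StrictMonoOn (fun h : ℝ => Station.diff (v h) n) (Set.Ici 0)) ∧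
    st.FullyIndexableInHolding ∧
    (∀ h : ℝ, 0 < h → st.FullyIndexableInCharge h) := by
  refine ⟨fun h hh => ⟨_, (st.isBias_iff hh).2 rfl, fun v hv => (st.isBias_iff hh).1 hv⟩,
    fun v hv n hn h hh h' hh' hlt => ?_, st.fullyIndexableInHolding,
    fun h hh => st.fullyIndexableInCharge hh⟩
  obtain ⟨m, rfl⟩ : ∃ m, n = m + 1 := ⟨n - 1, by omega⟩
  have e1 := (st.isBias_iff hh).1 (hv h hh)
  have e2 := (st.isBias_iff hh').1 (hv h' hh')
  simp only [e1, e2, Station.diff_partialSum (st.optDiff_zero _ 1)]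
  exact st.optDiff_lt_optDiff hh hlt zero_le_one m
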